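/- Let $n<7$ and let $\Omega\subset\mathbb{R}^n$ be open. Call $u$ a positive stable solution of $\Delta u=\frac1u$ on $\Omega$ if $u\in C^2(\Omega)$, $u>0$ and $\Delta u=\frac1u$ in $\Omega$, and $$\int_\Omega\frac{\zeta^2}{u^2}\,dx\le\int_\Omega|D\zeta|^2\,dx\qquad\text{for all }\zeta\in C^1_c(\Omega).$$ If $(u_j)_{j\in\mathbb{N}}$ is a sequence of positive stable solutions of $\Delta u=\frac1u$ on $\Omega$ converging pointwise on $\Omega$ to a function $u:\Omega\to\mathbb{R}$ (which is then nonnegative; in particular, the convergence may be uniform or locally uniform), then $u(x)\neq0$ for every $x\in\Omega$. That is, in dimension less than seven there are no singular stable solutions of $\Delta u=\frac1u$. -/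

import Mathlib

/-- `u` is a positive (classical, i.e. `C²`) solution of `Δ u = 1 / u` on the set `Ω ⊆ ℝⁿ`
(used for open `Ω`). -/
structure IsPositiveSolution {n : ℕ} (Ω : Set (EuclideanSpace ℝ (Fin n)))
    (u : EuclideanSpace ℝ (Fin n) → ℝ) : Prop where
  contDiffOn : ContDiffOn ℝ 2 u Ω
  pos : ∀ x ∈ Ω, 0 < u x
  laplacian_eq : ∀ x ∈ Ω, Laplacian.laplacian u x = 1 / u x

/-- The stability inequality on `Ω`: `∫_Ω ζ² / u² ≤ ∫_Ω |Dζ|²` for all test functions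
`ζ ∈ C¹_c(Ω)`, i.e. the second variation at `u` of `∫_Ω (|Du|² / 2 + log u)` is nonnegative. -/
def StabilityInequality {n : ℕ} (Ω : Set (EuclideanSpace ℝ (Fin n)))
    (u : EuclideanSpace ℝ (Fin n) → ℝ) : Prop :=
  ∀ ζ : EuclideanSpace ℝ (Fin n) → ℝ, ContDiff ℝ 1 ζ → HasCompactSupport ζ → tsupport ζ ⊆ Ω →
    ∫ x in Ω, ζ x ^ 2 / u x ^ 2 ≤ ∫ x in Ω, ‖gradient ζ x‖ ^ 2

/-- `u` is a positive stable solution of `Δ u = 1 / u` on `Ω`. -/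
structure IsPositiveStableSolution {n : ℕ} (Ω : Set (EuclideanSpace ℝ (Fin n)))
    (u : EuclideanSpace ℝ (Fin n) → ℝ) : Prop where
  isPositiveSolution : IsPositiveSolution Ω u
  stable : StabilityInequality Ω u

/-! Stability forces high integrability of `1/u`. Putting `ζ = u^(-q) φ^4` in the stability
inequality and testing the equation with `u^(-2q-1) φ^8` gives two relations between `∫ u^(-2q-2)
φ^8` and `∫ u^(-2q-2) |Du|² φ^8`; the latter can be absorbed when `q² < 2q + 1`. With `q = 9/4` this
bounds `∫ u^(-13/2)` on a smaller ball, uniformly over all stable solutions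
(`exists_integral_rpow_mul_pow_le`). The decisive point is `13/2 > 6 ≥ n`.

The bound prevents `u(x₀)` from being small. Since `Δu = 1/u`, it controls the radial growth of
weighted means: if `u(x₀) ≤ r`, the mean of `u` over the ball of radius `r` is at most `κ r`
(`integral_ballWeight_le`). Then `u ≤ 2κr` on a substantial part of that ball, so `∫ u^(-13/2)`
there is at least of order `r^(n - 13/2)`, which is unbounded as `r → 0`. Quantitatively `c ≤ C √r`
(`exists_pos_le_mul_sqrt`), with constants independent of the solution, so zero cannot be a limit
value. -/

open MeasureTheory InnerProductSpace

/-! ### Green's identity in rescaled coordinates. -/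

theorem laplacian_eq_sum_fderiv_fderiv {n : ℕ} {U : EuclideanSpace ℝ (Fin n) → ℝ}
    (hU : ContDiff ℝ 2 U) (x : EuclideanSpace ℝ (Fin n)) :
    Laplacian.laplacian U x = ∑ i, fderiv ℝ
      (fun z => fderiv ℝ U z (EuclideanSpace.basisFun (Fin n) ℝ i)) x
      (EuclideanSpace.basisFun (Fin n) ℝ i) := by
  rw [laplacian_eq_iteratedFDeriv_orthonormalBasis U (EuclideanSpace.basisFun (Fin n) ℝ)]
  refine Finset.sum_congr rfl fun i _ => ?_
  have hd : DifferentiableAt ℝ (fderiv ℝ U) x :=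
    ((hU.fderiv_right (m := 1) (by norm_num)).differentiable (by norm_num)) x
  rw [iteratedFDeriv_two_apply]
  rw [fderiv_clm_apply hd (differentiableAt_const _)]
  simp

/-- Green's identity against a rescaled function. -/
theorem integral_inner_gradient_comp_affine {n : ℕ} {f U : EuclideanSpace ℝ (Fin n) → ℝ}
    (hf : ContDiff ℝ 1 f) (hfc : HasCompactSupport f) (hU : ContDiff ℝ 2 U)
    (x₀ : EuclideanSpace ℝ (Fin n)) (s : ℝ) :
    ∫ y, inner ℝ (gradient f y) (gradient U (x₀ + s • y)) =
      -(s * ∫ y, f y * Laplacian.laplacian U (x₀ + s • y)) := by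
  set b := EuclideanSpace.basisFun (Fin n) ℝ
  have hfd : Continuous (fderiv ℝ f) := hf.continuous_fderiv (by norm_num)
  have hg : ∀ i, ContDiff ℝ 1 (fun z => fderiv ℝ U z (b i)) := fun i =>
    (hU.fderiv_right (m := 1) (by norm_num)).clm_apply contDiff_const
  have haff : ContDiff ℝ 1 (fun y : EuclideanSpace ℝ (Fin n) => x₀ + s • y) := by fun_prop
  have hgs : ∀ i, ContDiff ℝ 1 (fun y => fderiv ℝ U (x₀ + s • y) (b i)) := fun i =>
    (hg i).comp haff
  have hgd : ∀ i y, fderiv ℝ (fun y => fderiv ℝ U (x₀ + s • y) (b i)) y (b i) =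
      s * fderiv ℝ (fun z => fderiv ℝ U z (b i)) (x₀ + s • y) (b i) := by
    intro i y
    have h1 : HasFDerivAt (fun y : EuclideanSpace ℝ (Fin n) => x₀ + s • y)
        (s • ContinuousLinearMap.id ℝ _) y := ((hasFDerivAt_id y).const_smul s).const_add x₀
    have h2 := (((hg i).differentiable (by norm_num)) (x₀ + s • y)).hasFDerivAt
    have h3 := (h2.comp y h1).fderiv
    have : (fun y => fderiv ℝ U (x₀ + s • y) (b i)) =
      (fun z => fderiv ℝ U z (b i)) ∘ (fun y : EuclideanSpace ℝ (Fin n) => x₀ + s • y) := rfl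
    rw [this, h3]
    simp
  have hcf : ∀ i, HasCompactSupport (fun y => fderiv ℝ f y (b i)) := fun i =>
    (hfc.fderiv ℝ).comp_left (g := fun L : EuclideanSpace ℝ (Fin n) →L[ℝ] ℝ => L (b i)) rfl
  have hI1 : ∀ i, Integrable (fun y => fderiv ℝ f y (b i) * fderiv ℝ U (x₀ + s • y) (b i)) :=
    fun i => ((hfd.clm_apply continuous_const).mul (hgs i).continuous).integrable_of_hasCompactSupport
      ((hcf i).mul_right)
  have hI2 : ∀ i, Integrable (fun y => f y * fderiv ℝ
      (fun y => fderiv ℝ U (x₀ + s • y) (b i)) y (b i)) := fun i =>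
    (hf.continuous.mul (((hgs i).continuous_fderiv (by norm_num)).clm_apply
      continuous_const)).integrable_of_hasCompactSupport hfc.mul_right
  have hI3 : ∀ i, Integrable (fun y => f y * fderiv ℝ U (x₀ + s • y) (b i)) := fun i =>
    (hf.continuous.mul (hgs i).continuous).integrable_of_hasCompactSupport hfc.mul_right
  have hibp : ∀ i, ∫ y, fderiv ℝ f y (b i) * fderiv ℝ U (x₀ + s • y) (b i) =
      - ∫ y, f y * fderiv ℝ (fun y => fderiv ℝ U (x₀ + s • y) (b i)) y (b i) := by
    intro i
    rw [integral_mul_fderiv_eq_neg_fderiv_mul_of_integrable (hI1 i) (hI2 i) (hI3 i)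
      (fun x _ => hf.differentiable (by norm_num) x)
      (fun x _ => (hgs i).differentiable (by norm_num) x), neg_neg]
  have hL : ∀ y, inner ℝ (gradient f y) (gradient U (x₀ + s • y)) =
      ∑ i, fderiv ℝ f y (b i) * fderiv ℝ U (x₀ + s • y) (b i) := by
    intro y
    rw [← b.sum_inner_mul_inner]
    refine Finset.sum_congr rfl fun i _ => ?_
    rw [inner_gradient_left, real_inner_comm, inner_gradient_left]
  have hR : ∀ y, s * (f y * Laplacian.laplacian U (x₀ + s • y)) =
      ∑ i, f y * fderiv ℝ (fun y => fderiv ℝ U (x₀ + s • y) (b i)) y (b i) := by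
    intro y
    rw [laplacian_eq_sum_fderiv_fderiv hU, Finset.mul_sum, Finset.mul_sum]
    refine Finset.sum_congr rfl fun i _ => ?_
    rw [hgd]
    ring
  simp_rw [hL]
  rw [← integral_const_mul]
  simp_rw [hR]
  rw [integral_finsetSum _ (fun i _ => hI1 i), integral_finsetSum _ (fun i _ => hI2 i),
    ← Finset.sum_neg_distrib]
  exact Finset.sum_congr rfl fun i _ => hibp i

/-! ### A radial weight on the unit ball and its `C¹` potential. -/

theorem hasDerivAt_max_zero_sq (t : ℝ) :
    HasDerivAt (fun t : ℝ => max 0 t ^ 2) (2 * max 0 t) t := by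
  rcases lt_trichotomy t 0 with h | h | h
  · have : (fun t : ℝ => max 0 t ^ 2) =ᶠ[nhds t] fun _ => 0 := by
      filter_upwards [eventually_lt_nhds h] with x hx
      simp [max_eq_left hx.le]
    rw [max_eq_left h.le, mul_zero]
    exact (hasDerivAt_const t (0 : ℝ)).congr_of_eventuallyEq this
  · subst h
    rw [hasDerivAt_iff_isLittleO_nhds_zero]
    have h2 : (fun h : ℝ => h ^ 2) =o[nhds 0] fun h : ℝ => h := by
      simpa using Asymptotics.isLittleO_pow_id (𝕜 := ℝ) (n := 2) (by norm_num)
    refine Asymptotics.IsBigO.trans_isLittleO ?_ h2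
    refine Asymptotics.IsBigO.of_bound 1 (Filter.Eventually.of_forall fun h => ?_)
    simp only [zero_add, max_self, smul_zero, mul_zero, sub_zero, norm_pow, Real.norm_eq_abs,
      one_mul, ne_eq, OfNat.ofNat_ne_zero, not_false_eq_true, zero_pow]
    refine pow_le_pow_left₀ (abs_nonneg _) ?_ 2
    exact abs_le_abs_of_nonneg (le_max_left _ _) (max_le (abs_nonneg h) (le_abs_self h)) |>.trans
      (abs_abs h).le
  · have : (fun t : ℝ => max 0 t ^ 2) =ᶠ[nhds t] fun t => t ^ 2 := by
      filter_upwards [eventually_gt_nhds h] with x hx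
      simp [max_eq_right hx.le]
    rw [max_eq_right h.le]
    have h3 := (hasDerivAt_pow 2 t).congr_of_eventuallyEq this
    simpa using h3

theorem contDiff_max_zero_sq : ContDiff ℝ 1 (fun t : ℝ => max 0 t ^ 2) := by
  rw [contDiff_one_iff_deriv]
  refine ⟨fun t => (hasDerivAt_max_zero_sq t).differentiableAt, ?_⟩
  rw [show deriv (fun t : ℝ => max 0 t ^ 2) = fun t => 2 * max 0 t from
    funext fun t => (hasDerivAt_max_zero_sq t).deriv]
  fun_prop

section Weight

variable {E : Type*} [NormedAddCommGroup E]

/-- The weight `4 (1 - |y|²)₊` on the unit ball. -/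
noncomputable def ballWeight (y : E) : ℝ := 4 * max 0 (1 - ‖y‖ ^ 2)

/-- A potential of `y ↦ -ballWeight y • y`. -/
noncomputable def ballPotential (y : E) : ℝ := max 0 (1 - ‖y‖ ^ 2) ^ 2

theorem continuous_ballWeight : Continuous (ballWeight : E → ℝ) := by
  unfold ballWeight; fun_prop

theorem ballWeight_nonneg (y : E) : 0 ≤ ballWeight y := by
  unfold ballWeight; positivity

theorem ballPotential_nonneg (y : E) : 0 ≤ ballPotential y := by
  unfold ballPotential; positivity

theorem ballWeight_le (y : E) : ballWeight y ≤ 4 := by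
  have : max 0 (1 - ‖y‖ ^ 2) ≤ 1 := max_le zero_le_one (by nlinarith [sq_nonneg ‖y‖])
  unfold ballWeight; linarith

theorem ballPotential_le (y : E) : ballPotential y ≤ 1 := by
  have : max 0 (1 - ‖y‖ ^ 2) ≤ 1 := max_le zero_le_one (by nlinarith [sq_nonneg ‖y‖])
  exact pow_le_one₀ (le_max_left _ _) this

theorem ballWeight_eq_zero {y : E} (hy : 1 ≤ ‖y‖) : ballWeight y = 0 := by
  unfold ballWeight
  rw [max_eq_left (by nlinarith), mul_zero]

theorem ballPotential_eq_zero {y : E} (hy : 1 ≤ ‖y‖) : ballPotential y = 0 := by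
  unfold ballPotential
  rw [max_eq_left (by nlinarith)]
  norm_num

theorem hasCompactSupport_ballWeight [ProperSpace E] :
    HasCompactSupport (ballWeight : E → ℝ) :=
  HasCompactSupport.intro (isCompact_closedBall 0 1) fun x hx => ballWeight_eq_zero (by
    simp only [Metric.mem_closedBall, dist_zero_right, not_le] at hx; exact hx.le)

theorem hasCompactSupport_ballPotential [ProperSpace E] :
    HasCompactSupport (ballPotential : E → ℝ) :=
  HasCompactSupport.intro (isCompact_closedBall 0 1) fun x hx => ballPotential_eq_zero (by
    simp only [Metric.mem_closedBall, dist_zero_right, not_le] at hx; exact hx.le)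

variable [InnerProductSpace ℝ E]

theorem contDiff_ballPotential : ContDiff ℝ 1 (ballPotential : E → ℝ) :=
  contDiff_max_zero_sq.comp (contDiff_const.sub (contDiff_norm_sq ℝ))

theorem gradient_ballPotential [CompleteSpace E] (y : E) :
    gradient (ballPotential : E → ℝ) y = -(ballWeight y • y) := by
  refine HasGradientAt.gradient ?_
  rw [hasGradientAt_iff_hasFDerivAt]
  have h1 := (hasStrictFDerivAt_norm_sq y).hasFDerivAt.const_sub 1
  have h2 := (hasDerivAt_max_zero_sq (1 - ‖y‖ ^ 2)).comp_hasFDerivAt y h1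
  refine h2.congr_fderiv ?_
  ext z
  simp only [ballWeight, map_neg, map_smul, smul_apply,
    neg_apply, toDual_apply_apply, smul_eq_mul, innerSL_apply_apply, nsmul_eq_mul]
  push_cast
  ring

end Weight

/-! ### Growth of weighted means. -/

theorem fderiv_bounded_of_sub_one {E : Type*} [NormedAddCommGroup E] [NormedSpace ℝ E]
    {U : E → ℝ} (hU : ContDiff ℝ 1 U) (hUc : HasCompactSupport fun x => U x - 1) :
    ∃ K, ∀ x, ‖fderiv ℝ U x‖ ≤ K := by
  have h : (fderiv ℝ fun x => U x - 1) = fderiv ℝ U := by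
    funext x
    exact fderiv_sub_const 1
  have hc := hUc.fderiv ℝ
  rw [h] at hc
  exact hc.exists_bound_of_continuous (hU.continuous_fderiv (by norm_num))

/-- The two terms cover `s ≤ t` and `t ≤ s` respectively. The cut at `t = s` is the natural scale
for linear growth of the mean. -/
theorem inv_le_inv_add_rpow_mul_rpow {s t : ℝ} (hs : 0 < s) (ht : 0 < t) :
    1 / t ≤ s⁻¹ + s ^ (11 / 2 : ℝ) * t ^ (-(13 / 2) : ℝ) := by
  rcases le_total s t with h | h
  · have h1 : 1 / t ≤ s⁻¹ := by rw [one_div]; gcongr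
    have h2 : 0 ≤ s ^ (11 / 2 : ℝ) * t ^ (-(13 / 2) : ℝ) := by positivity
    linarith
  · have h1 : t ^ (11 / 2 : ℝ) * t ^ (-(13 / 2) : ℝ) = 1 / t := by
      rw [← Real.rpow_add ht, one_div, ← Real.rpow_neg_one]
      norm_num
    have h2 : t ^ (11 / 2 : ℝ) * t ^ (-(13 / 2) : ℝ) ≤ s ^ (11 / 2 : ℝ) * t ^ (-(13 / 2) : ℝ) := by
      gcongr
    have h3 : 0 < s⁻¹ := by positivity
    linarith

theorem ballPotential_mul_laplacian_eq {n : ℕ} {U : EuclideanSpace ℝ (Fin n) → ℝ}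
    {x₀ : EuclideanSpace ℝ (Fin n)} {r s : ℝ} (hs : 0 < s) (hsr : s ≤ r)
    (hL : ∀ x ∈ Metric.ball x₀ r, Laplacian.laplacian U x = 1 / U x)
    (y : EuclideanSpace ℝ (Fin n)) :
    ballPotential y * Laplacian.laplacian U (x₀ + s • y) =
      ballPotential y * (1 / U (x₀ + s • y)) := by
  rcases le_or_gt 1 ‖y‖ with hy | hy
  · rw [ballPotential_eq_zero hy, zero_mul, zero_mul]
  · rw [hL]
    rw [Metric.mem_ball, dist_eq_norm, add_sub_cancel_left, norm_smul, Real.norm_of_nonneg hs.le]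
    nlinarith

/-- Differentiating under the integral produces `DU(x₀ + s y) · y`. As `ballWeight y • y` is minus
the gradient of `ballPotential`, Green's identity turns this into the Laplacian, the extra factor
`s` coming from the rescaling. -/
theorem hasDerivAt_integral_ballWeight {n : ℕ} {U : EuclideanSpace ℝ (Fin n) → ℝ}
    (hU : ContDiff ℝ 2 U) (hUc : HasCompactSupport fun x => U x - 1)
    (x₀ : EuclideanSpace ℝ (Fin n)) (s : ℝ) :
    HasDerivAt (fun s => ∫ y, ballWeight y * U (x₀ + s • y))
      (s * ∫ y, ballPotential y * Laplacian.laplacian U (x₀ + s • y)) s := by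
  obtain ⟨K, hK⟩ := fderiv_bounded_of_sub_one (hU.of_le (by norm_num)) hUc
  have hUd : Differentiable ℝ U := hU.differentiable (by norm_num)
  have hfd : Continuous (fderiv ℝ U) := hU.continuous_fderiv (by norm_num)
  have hw := continuous_ballWeight (E := EuclideanSpace ℝ (Fin n))
  have hwc := hasCompactSupport_ballWeight (E := EuclideanSpace ℝ (Fin n))
  have key := hasDerivAt_integral_of_dominated_loc_of_deriv_le (μ := volume)
    (F := fun (s : ℝ) (y : EuclideanSpace ℝ (Fin n)) => ballWeight y * U (x₀ + s • y))
    (F' := fun s y => ballWeight y * fderiv ℝ U (x₀ + s • y) y) (x₀ := s) (s := Set.univ)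
    (bound := fun y => ballWeight y * K) Filter.univ_mem
    (Filter.Eventually.of_forall fun s => (hw.mul (hUd.continuous.comp
      (by fun_prop))).aestronglyMeasurable)
    ((hw.mul (hUd.continuous.comp (by fun_prop))).integrable_of_hasCompactSupport hwc.mul_right)
    (hw.mul ((hfd.comp (by fun_prop)).clm_apply continuous_id)).aestronglyMeasurable
    (Filter.Eventually.of_forall fun y s _ => by
      rw [norm_mul, Real.norm_of_nonneg (ballWeight_nonneg y)]
      rcases le_or_gt 1 ‖y‖ with hy | hy
      · rw [ballWeight_eq_zero hy, zero_mul, zero_mul]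
      · refine mul_le_mul_of_nonneg_left ?_ (ballWeight_nonneg y)
        refine ((fderiv ℝ U (x₀ + s • y)).le_opNorm y).trans ?_
        have := hK (x₀ + s • y)
        have h0 := norm_nonneg (fderiv ℝ U (x₀ + s • y))
        nlinarith [norm_nonneg y])
    ((hw.mul continuous_const).integrable_of_hasCompactSupport hwc.mul_right)
    (Filter.Eventually.of_forall fun y s _ => by
      have h1 : HasDerivAt (fun s : ℝ => x₀ + s • y) y s := by
        simpa using ((hasDerivAt_id s).smul_const y).const_add x₀
      exact ((hUd (x₀ + s • y)).hasFDerivAt.comp_hasDerivAt s h1).const_mul (ballWeight y))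
  have hG := integral_inner_gradient_comp_affine contDiff_ballPotential
    hasCompactSupport_ballPotential hU x₀ s
  have hE : ∀ y : EuclideanSpace ℝ (Fin n),
      inner ℝ (gradient (ballPotential : EuclideanSpace ℝ (Fin n) → ℝ) y)
        (gradient U (x₀ + s • y)) = -(ballWeight y * fderiv ℝ U (x₀ + s • y) y) := by
    intro y
    rw [gradient_ballPotential, inner_neg_left, real_inner_smul_left, real_inner_comm,
      inner_gradient_left]
  simp_rw [hE, integral_neg, neg_inj] at hG
  rw [← hG]
  exact key.2

/-- The weighted mean of a solution grows at most linearly, given a bound for its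
negative power `-13/2` on small balls. -/
theorem integral_ballWeight_le {n : ℕ} (hn : n < 7) {U : EuclideanSpace ℝ (Fin n) → ℝ}
    (hU : ContDiff ℝ 2 U) (hUc : HasCompactSupport fun x => U x - 1) (hpos : ∀ x, 0 < U x)
    {x₀ : EuclideanSpace ℝ (Fin n)} {r C : ℝ} (hr : 0 < r) (hr1 : r ≤ 1)
    (hL : ∀ x ∈ Metric.ball x₀ r, Laplacian.laplacian U x = 1 / U x)
    (hC : ∀ s, 0 < s → s < r →
      ∫ y, ballPotential y * U (x₀ + s • y) ^ (-(13 / 2) : ℝ) ≤ C * (s ^ n)⁻¹) (hC0 : 0 ≤ C) :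
    ∫ y, ballWeight y * U (x₀ + r • y) ≤
      (∫ y : EuclideanSpace ℝ (Fin n), ballWeight y) * U x₀ +
      ((∫ y : EuclideanSpace ℝ (Fin n), ballPotential y) + C) * r := by
  have hd := hasDerivAt_integral_ballWeight hU hUc x₀
  set M : ℝ → ℝ := fun s => ∫ y, ballWeight y * U (x₀ + s • y) with hM
  have hGc := contDiff_ballPotential (E := EuclideanSpace ℝ (Fin n)).continuous
  have hGs := hasCompactSupport_ballPotential (E := EuclideanSpace ℝ (Fin n))
  have hderiv : ∀ s ∈ Set.Ioo 0 r, deriv M s ≤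
      (∫ y : EuclideanSpace ℝ (Fin n), ballPotential y) + C := by
    rintro s ⟨hs, hsr⟩
    rw [(hd s).deriv]
    simp_rw [ballPotential_mul_laplacian_eq hs hsr.le hL]
    have hUs : Continuous fun y : EuclideanSpace ℝ (Fin n) => U (x₀ + s • y) :=
      hU.continuous.comp (by fun_prop)
    have hUp : Continuous fun y : EuclideanSpace ℝ (Fin n) =>
        U (x₀ + s • y) ^ (-(13 / 2) : ℝ) :=
      hUs.rpow_const fun y => Or.inl (hpos _).ne'
    have hI1 : Integrable fun y : EuclideanSpace ℝ (Fin n) =>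
        ballPotential y * U (x₀ + s • y) ^ (-(13 / 2) : ℝ) :=
      (hGc.mul hUp).integrable_of_hasCompactSupport hGs.mul_right
    have hI0 : Integrable (ballPotential : EuclideanSpace ℝ (Fin n) → ℝ) :=
      hGc.integrable_of_hasCompactSupport hGs
    have hI2 : Integrable fun y : EuclideanSpace ℝ (Fin n) =>
        ballPotential y * (1 / U (x₀ + s • y)) :=
      (hGc.mul (continuous_const.div hUs fun y => (hpos _).ne')).integrable_of_hasCompactSupport
        hGs.mul_right
    have h1 : ∫ y, ballPotential y * (1 / U (x₀ + s • y)) ≤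
        ∫ y, (s⁻¹ * ballPotential y + s ^ (11 / 2 : ℝ) *
          (ballPotential y * U (x₀ + s • y) ^ (-(13 / 2) : ℝ))) := by
      refine integral_mono hI2 ((hI0.const_mul _).add (hI1.const_mul _)) fun y => ?_
      have := mul_le_mul_of_nonneg_left (inv_le_inv_add_rpow_mul_rpow hs (hpos (x₀ + s • y)))
        (ballPotential_nonneg y)
      dsimp only
      linarith
    rw [integral_add (hI0.const_mul _) (hI1.const_mul _), integral_const_mul,
      integral_const_mul] at h1
    have h2 := mul_le_mul_of_nonneg_left (hC s hs hsr)
      (show (0 : ℝ) ≤ s ^ (11 / 2 : ℝ) by positivity)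
    -- The total power `13/2 - n` of `s` is positive because `n ≤ 6`, and `s ≤ 1`.
    have h3 : s * s ^ (11 / 2 : ℝ) * (s ^ n)⁻¹ ≤ 1 := by
      rw [← div_eq_mul_inv, div_le_one (by positivity)]
      nth_rewrite 1 [← Real.rpow_one s]
      rw [← Real.rpow_add hs, ← Real.rpow_natCast]
      refine Real.rpow_le_rpow_of_exponent_ge hs (hsr.le.trans hr1) ?_
      have : (n : ℝ) ≤ 6 := by exact_mod_cast Nat.lt_succ_iff.mp hn
      linarith
    calc _ ≤ s * (s⁻¹ * (∫ y : EuclideanSpace ℝ (Fin n), ballPotential y) +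
            s ^ (11 / 2 : ℝ) * (C * (s ^ n)⁻¹)) := by
          refine mul_le_mul_of_nonneg_left ?_ hs.le
          linarith
      _ = (∫ y : EuclideanSpace ℝ (Fin n), ballPotential y) +
            C * (s * s ^ (11 / 2 : ℝ) * (s ^ n)⁻¹) := by
          field_simp
      _ ≤ _ := by nlinarith
  have := (convex_Icc 0 r).image_sub_le_mul_sub_of_deriv_le (f := M)
    (fun s _ => (hd s).continuousAt.continuousWithinAt)
    (fun s _ => (hd s).differentiableAt.differentiableWithinAt)
    (by rw [interior_Icc]; exact hderiv) 0 (by simp [hr.le]) r (by simp [hr.le]) hr.le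
  have h0 : M 0 = (∫ y : EuclideanSpace ℝ (Fin n), ballWeight y) * U x₀ := by
    simp only [hM, zero_smul, add_zero]
    exact integral_mul_const _ _
  rw [h0, sub_zero] at this
  change M r ≤ _
  linarith

/-! ### The integral estimate from stability. -/

theorem hasGradientAt_rpow_mul_pow {E : Type*} [NormedAddCommGroup E] [InnerProductSpace ℝ E]
    [CompleteSpace E] {U φ : E → ℝ} {x : E} (hU : DifferentiableAt ℝ U x)
    (hφ : DifferentiableAt ℝ φ x) (hpos : 0 < U x) (q : ℝ) (m : ℕ) :
    HasGradientAt (fun x => U x ^ q * φ x ^ (m + 1))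
      ((q * U x ^ (q - 1) * φ x ^ (m + 1)) • gradient U x +
        ((m + 1) * U x ^ q * φ x ^ m) • gradient φ x) x := by
  rw [hasGradientAt_iff_hasFDerivAt]
  have h1 := (hU.hasFDerivAt.rpow_const (p := q) (Or.inl hpos.ne')).mul
    (hφ.hasFDerivAt.pow (m + 1))
  refine h1.congr_fderiv ?_
  ext v
  simp only [add_apply, smul_apply, map_add, map_smul, toDual_apply_apply, inner_gradient_left,
    smul_eq_mul, nsmul_eq_mul]
  rw [Nat.add_sub_cancel]
  push_cast
  ring

theorem continuous_gradient {E : Type*} [NormedAddCommGroup E] [InnerProductSpace ℝ E]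
    [CompleteSpace E] {f : E → ℝ} (hf : ContDiff ℝ 1 f) : Continuous (gradient f) :=
  (toDual ℝ E).symm.continuous.comp (hf.continuous_fderiv (by norm_num))

theorem gradient_eq_zero_of_notMem_tsupport {E : Type*} [NormedAddCommGroup E]
    [InnerProductSpace ℝ E] [CompleteSpace E] {f : E → ℝ} {x : E} (hx : x ∉ tsupport f) :
    gradient f x = 0 := by
  have : fderiv ℝ f x = 0 := by
    by_contra h
    exact hx (support_fderiv_subset ℝ h)
  rw [gradient, this, map_zero]

/-- A Young inequality, by cases: for `u² ≤ δ φ²` the first term on the right suffices; otherwise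
`u^(-9/2) ≤ (δ φ²)^(-9/4)`, and `φ^6` outweighs the resulting `φ^(-9/2)`. -/
theorem rpow_mul_pow_le {u φ δ : ℝ} (hu : 0 < u) (h0 : 0 ≤ φ) (h1 : φ ≤ 1) (hδ : 0 < δ) :
    u ^ (-(9 / 2) : ℝ) * φ ^ 6 ≤ δ * (u ^ (-(13 / 2) : ℝ) * φ ^ 8) + δ ^ (-(9 / 4) : ℝ) := by
  have hδ' : 0 < δ ^ (-(9 / 4) : ℝ) := by positivity
  have hu' : 0 < u ^ (-(13 / 2) : ℝ) := by positivity
  rcases h0.eq_or_lt with rfl | hφ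
  · simpa using hδ'.le
  have e : u ^ (-(9 / 2) : ℝ) = u ^ (-(13 / 2) : ℝ) * u ^ 2 := by
    rw [← Real.rpow_natCast, ← Real.rpow_add hu]
    norm_num
  rcases le_total (u ^ 2) (δ * φ ^ 2) with h | h
  · have : u ^ (-(9 / 2) : ℝ) * φ ^ 6 ≤ δ * (u ^ (-(13 / 2) : ℝ) * φ ^ 8) := by
      rw [e]
      calc _ = (u ^ (-(13 / 2) : ℝ) * φ ^ 6) * u ^ 2 := by ring
        _ ≤ (u ^ (-(13 / 2) : ℝ) * φ ^ 6) * (δ * φ ^ 2) := by gcongr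
        _ = _ := by ring
    linarith
  · have h2 : u ^ (-(9 / 2) : ℝ) ≤ δ ^ (-(9 / 4) : ℝ) * φ ^ (-(9 / 2) : ℝ) := by
      have : (u ^ 2) ^ (-(9 / 4) : ℝ) ≤ (δ * φ ^ 2) ^ (-(9 / 4) : ℝ) :=
        Real.rpow_le_rpow_of_nonpos (by positivity) h (by norm_num)
      rw [Real.mul_rpow hδ.le (by positivity), ← Real.rpow_natCast, ← Real.rpow_mul hu.le,
        ← Real.rpow_natCast, ← Real.rpow_mul h0] at this
      norm_num at this ⊢
      exact this
    have h3 : φ ^ (-(9 / 2) : ℝ) * φ ^ 6 ≤ 1 := by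
      rw [← Real.rpow_natCast, ← Real.rpow_add hφ]
      exact Real.rpow_le_one h0 h1 (by norm_num)
    have h4 : u ^ (-(9 / 2) : ℝ) * φ ^ 6 ≤ δ ^ (-(9 / 4) : ℝ) := by
      calc _ ≤ (δ ^ (-(9 / 4) : ℝ) * φ ^ (-(9 / 2) : ℝ)) * φ ^ 6 := by gcongr
        _ = δ ^ (-(9 / 4) : ℝ) * (φ ^ (-(9 / 2) : ℝ) * φ ^ 6) := by ring
        _ ≤ δ ^ (-(9 / 4) : ℝ) * 1 := by gcongr
        _ = _ := mul_one _
    have : 0 ≤ δ * (u ^ (-(13 / 2) : ℝ) * φ ^ 8) := by positivity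
    linarith

section Estimate

variable {n : ℕ} {U φ : EuclideanSpace ℝ (Fin n) → ℝ} {S : Set (EuclideanSpace ℝ (Fin n))}

/-- Write `I` for the left integral, `A = ∫ ‖a‖²`, `B = ∫ ‖b‖²`, `X = ∫ ⟨a, b⟩`, with `a`, `b` as in
the proof. The equation gives `I = 11/2 A - 8 X`, stability gives `I ≤ 81/16 A - 18 X + 16 B`. Since
`81/16 < 11/2`, `A` is bounded by a multiple of `B`, and hence so is `I`. -/
theorem integral_rpow_mul_pow_le_integral_norm_gradient_sq
    (hφ : ContDiff ℝ 1 φ) (hφc : HasCompactSupport φ) (hφS : tsupport φ ⊆ S)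
    (hU : ContDiff ℝ 2 U) (hpos : ∀ x, 0 < U x)
    (hL : ∀ x ∈ S, Laplacian.laplacian U x = 1 / U x)
    (hst : ∀ ζ : EuclideanSpace ℝ (Fin n) → ℝ, ContDiff ℝ 1 ζ → HasCompactSupport ζ →
      tsupport ζ ⊆ S → ∫ x, ζ x ^ 2 / U x ^ 2 ≤ ∫ x, ‖gradient ζ x‖ ^ 2) :
    ∫ x, U x ^ (-(13 / 2) : ℝ) * φ x ^ 8 ≤
      35000 * ∫ x, U x ^ (-(9 / 2) : ℝ) * φ x ^ 6 * ‖gradient φ x‖ ^ 2 := by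
  have hU1 : ContDiff ℝ 1 U := hU.of_le (by norm_num)
  have hUd : Differentiable ℝ U := hU.differentiable (by norm_num)
  have hφd : Differentiable ℝ φ := hφ.differentiable (by norm_num)
  have hUp : ∀ q : ℝ, ContDiff ℝ 1 fun x => U x ^ q := fun q =>
    hU1.rpow_const_of_ne fun x => (hpos x).ne'
  have hs : ∀ x ∉ tsupport φ, φ x = 0 := fun x hx => image_eq_zero_of_notMem_tsupport hx
  have hts : ∀ (q : ℝ) (m : ℕ), tsupport (fun x => U x ^ q * φ x ^ (m + 1)) ⊆ tsupport φ := by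
    intro q m
    refine closure_mono fun x hx hx0 => hx ?_
    simp [hx0]
  set a : EuclideanSpace ℝ (Fin n) → EuclideanSpace ℝ (Fin n) := fun x =>
    (U x ^ (-(13 / 4) : ℝ) * φ x ^ 4) • gradient U x with ha
  set b : EuclideanSpace ℝ (Fin n) → EuclideanSpace ℝ (Fin n) := fun x =>
    (U x ^ (-(9 / 4) : ℝ) * φ x ^ 3) • gradient φ x with hb
  have hac : Continuous a := ((hUp _).continuous.mul (hφ.continuous.pow 4)).smul
    (continuous_gradient hU1)
  have hbc : Continuous b := ((hUp _).continuous.mul (hφ.continuous.pow 3)).smul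
    (continuous_gradient hφ)
  have ha0 : ∀ x ∉ tsupport φ, a x = 0 := fun x hx => by simp [ha, hs x hx]
  have hb0 : ∀ x ∉ tsupport φ, b x = 0 := fun x hx => by simp [hb, hs x hx]
  have hIa : Integrable fun x => ‖a x‖ ^ 2 :=
    (hac.norm.pow 2).integrable_of_hasCompactSupport
      (HasCompactSupport.intro hφc fun x hx => by simp [ha0 x hx])
  have hIb : Integrable fun x => ‖b x‖ ^ 2 :=
    (hbc.norm.pow 2).integrable_of_hasCompactSupport
      (HasCompactSupport.intro hφc fun x hx => by simp [hb0 x hx])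
  have hIab : Integrable fun x => inner ℝ (a x) (b x) :=
    (hac.inner hbc).integrable_of_hasCompactSupport
      (HasCompactSupport.intro hφc fun x hx => by simp [ha0 x hx])
  -- the equation
  have e1 := integral_inner_gradient_comp_affine ((hUp (-(11 / 2))).mul (hφ.pow (7 + 1)))
    (HasCompactSupport.of_support_subset_isCompact hφc
      ((subset_tsupport _).trans (hts (-(11 / 2)) 7))) hU 0 1
  have e2 : ∀ x, inner ℝ (gradient (fun x => U x ^ (-(11 / 2) : ℝ) * φ x ^ (7 + 1)) x)
      (gradient U (0 + (1 : ℝ) • x)) = -(11 / 2) * ‖a x‖ ^ 2 + 8 * inner ℝ (a x) (b x) := by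
    intro x
    rw [(hasGradientAt_rpow_mul_pow (hUd x) (hφd x) (hpos x) _ 7).gradient, zero_add, one_smul]
    simp only [ha, hb, inner_add_left, real_inner_smul_left, real_inner_smul_right, norm_smul,
      mul_pow, real_inner_self_eq_norm_sq]
    rw [real_inner_comm (gradient φ x), Real.norm_eq_abs, sq_abs]
    have h1 : U x ^ (-(11 / 2) - 1 : ℝ) = U x ^ (-(13 / 4) : ℝ) * U x ^ (-(13 / 4) : ℝ) := by
      rw [← Real.rpow_add (hpos x)]; norm_num
    have h2 : U x ^ (-(11 / 2) : ℝ) = U x ^ (-(13 / 4) : ℝ) * U x ^ (-(9 / 4) : ℝ) := by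
      rw [← Real.rpow_add (hpos x)]; norm_num
    rw [h1, h2]
    push_cast
    ring
  have e3 : ∀ x, U x ^ (-(11 / 2) : ℝ) * φ x ^ (7 + 1) *
      Laplacian.laplacian U (0 + (1 : ℝ) • x) = U x ^ (-(13 / 2) : ℝ) * φ x ^ 8 := by
    intro x
    rw [zero_add, one_smul]
    by_cases hx : x ∈ tsupport φ
    · rw [hL x (hφS hx)]
      have : U x ^ (-(13 / 2) : ℝ) = U x ^ (-(11 / 2) : ℝ) * (1 / U x) := by
        rw [one_div, ← Real.rpow_neg_one, ← Real.rpow_add (hpos x)]; norm_num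
      rw [this]
      ring
    · simp [hs x hx]
  simp_rw [e2, e3] at e1
  rw [integral_add (hIa.const_mul _) (hIab.const_mul _), integral_const_mul, integral_const_mul,
    one_mul] at e1
  -- stability
  have s1 := hst (fun x => U x ^ (-(9 / 4) : ℝ) * φ x ^ (3 + 1))
    ((hUp _).mul (hφ.pow _)) (HasCompactSupport.of_support_subset_isCompact hφc
      ((subset_tsupport _).trans (hts _ 3))) ((hts _ 3).trans hφS)
  have s2 : ∀ x, ‖gradient (fun x => U x ^ (-(9 / 4) : ℝ) * φ x ^ (3 + 1)) x‖ ^ 2 =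
      81 / 16 * ‖a x‖ ^ 2 + (-18) * inner ℝ (a x) (b x) + 16 * ‖b x‖ ^ 2 := by
    intro x
    rw [(hasGradientAt_rpow_mul_pow (hUd x) (hφd x) (hpos x) _ 3).gradient]
    have : (-(9 / 4) * U x ^ (-(9 / 4) - 1 : ℝ) * φ x ^ (3 + 1)) • gradient U x +
        (((3 : ℕ) + 1) * U x ^ (-(9 / 4) : ℝ) * φ x ^ 3) • gradient φ x =
        (-(9 / 4) : ℝ) • a x + (4 : ℝ) • b x := by
      simp only [ha, hb, smul_smul]
      norm_num [mul_assoc]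
    rw [this, norm_add_sq_real, norm_smul _ (a x), norm_smul _ (b x), real_inner_smul_left,
      real_inner_smul_right, mul_pow, mul_pow, Real.norm_eq_abs, Real.norm_eq_abs, sq_abs, sq_abs]
    ring
  have s3 : ∀ x, (U x ^ (-(9 / 4) : ℝ) * φ x ^ (3 + 1)) ^ 2 / U x ^ 2 =
      U x ^ (-(13 / 2) : ℝ) * φ x ^ 8 := by
    intro x
    have : U x ^ (-(13 / 2) : ℝ) * U x ^ 2 = (U x ^ (-(9 / 4) : ℝ)) ^ 2 := by
      rw [← Real.rpow_natCast, ← Real.rpow_natCast, ← Real.rpow_mul (hpos x).le,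
        ← Real.rpow_add (hpos x)]
      norm_num
    have h0 := (hpos x).ne'
    rw [mul_pow, ← this]
    field_simp
    ring
  simp_rw [s2, s3] at s1
  have hIs : Integrable fun x => 81 / 16 * ‖a x‖ ^ 2 + (-18) * inner ℝ (a x) (b x) :=
    (hIa.const_mul _).add (hIab.const_mul _)
  rw [integral_add hIs (hIb.const_mul _), integral_add (hIa.const_mul _) (hIab.const_mul _), integral_const_mul, integral_const_mul,
    integral_const_mul] at s1
  -- Cauchy inequality
  have c1 : |∫ x, inner ℝ (a x) (b x)| ≤
      1 / 1000 * (∫ x, ‖a x‖ ^ 2) + 250 * ∫ x, ‖b x‖ ^ 2 := by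
    rw [← integral_const_mul, ← integral_const_mul,
      ← integral_add (hIa.const_mul _) (hIb.const_mul _)]
    refine (abs_integral_le_integral_abs).trans
      (integral_mono hIab.abs ((hIa.const_mul _).add (hIb.const_mul _)) fun x => ?_)
    have := abs_real_inner_le_norm (a x) (b x)
    dsimp only
    nlinarith [sq_nonneg (‖a x‖ - 500 * ‖b x‖)]
  have b1 : ∀ x, ‖b x‖ ^ 2 = U x ^ (-(9 / 2) : ℝ) * φ x ^ 6 * ‖gradient φ x‖ ^ 2 := by
    intro x
    simp only [hb, norm_smul, mul_pow, Real.norm_eq_abs, sq_abs]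
    have : (U x ^ (-(9 / 4) : ℝ)) ^ 2 = U x ^ (-(9 / 2) : ℝ) := by
      rw [← Real.rpow_natCast, ← Real.rpow_mul (hpos x).le]
      norm_num
    rw [this]
    ring
  simp_rw [b1] at s1 c1
  have c2 := abs_le.1 c1
  have hE0 : 0 ≤ ∫ x, U x ^ (-(9 / 2) : ℝ) * φ x ^ 6 * ‖gradient φ x‖ ^ 2 :=
    integral_nonneg fun x => by
      have := hpos x
      dsimp only
      positivity
  -- Eliminating `I` leaves `7/16 A ≤ -10 X + 16 B`. The weight `1/1000` in the Cauchy inequality is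
  -- small enough to absorb `X`, and 35000 is a rounded-up constant.
  linarith [c2.1, c2.2]

/-- Uniform interior bound for the negative power `-13/2` of stable solutions. -/
theorem exists_integral_rpow_mul_pow_le (hφ : ContDiff ℝ 1 φ) (hφc : HasCompactSupport φ)
    (hφS : tsupport φ ⊆ S) (h0 : ∀ x, 0 ≤ φ x) (h1 : ∀ x, φ x ≤ 1) :
    ∃ C, 0 ≤ C ∧ ∀ U : EuclideanSpace ℝ (Fin n) → ℝ, ContDiff ℝ 2 U → (∀ x, 0 < U x) →
      (∀ x ∈ S, Laplacian.laplacian U x = 1 / U x) →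
      (∀ ζ : EuclideanSpace ℝ (Fin n) → ℝ, ContDiff ℝ 1 ζ → HasCompactSupport ζ →
        tsupport ζ ⊆ S → ∫ x, ζ x ^ 2 / U x ^ 2 ≤ ∫ x, ‖gradient ζ x‖ ^ 2) →
      ∫ x, U x ^ (-(13 / 2) : ℝ) * φ x ^ 8 ≤ C := by
  have hgc := continuous_gradient hφ
  have hgs : HasCompactSupport (gradient φ) :=
    HasCompactSupport.intro hφc fun x hx => gradient_eq_zero_of_notMem_tsupport hx
  obtain ⟨K, hK⟩ := hgs.exists_bound_of_continuous hgc
  -- Makes `35000 δ K² ≤ 1/2`, so half of the left side survives absorption; hence the doubled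
  -- constant 70000 below.
  set δ : ℝ := 1 / (70000 * (K ^ 2 + 1)) with hδ
  have hδ0 : 0 < δ := by positivity
  have hδK : 35000 * (δ * K ^ 2) ≤ 1 / 2 := by
    rw [hδ]
    field_simp
    nlinarith [sq_nonneg K]
  have hIg : Integrable fun x => ‖gradient φ x‖ ^ 2 :=
    (hgc.norm.pow 2).integrable_of_hasCompactSupport
      (HasCompactSupport.intro hφc fun x hx => by
        simp [gradient_eq_zero_of_notMem_tsupport hx])
  refine ⟨70000 * (δ ^ (-(9 / 4) : ℝ) * ∫ x, ‖gradient φ x‖ ^ 2), ?_, ?_⟩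
  · have : 0 ≤ ∫ x, ‖gradient φ x‖ ^ 2 := integral_nonneg fun x => by positivity
    positivity
  intro U hU hpos hL hst
  have key := integral_rpow_mul_pow_le_integral_norm_gradient_sq hφ hφc hφS hU hpos hL hst
  have hUp : ∀ q : ℝ, Continuous fun x => U x ^ q := fun q =>
    hU.continuous.rpow_const fun x => Or.inl (hpos x).ne'
  have hs : ∀ x ∉ tsupport φ, φ x = 0 := fun x hx => image_eq_zero_of_notMem_tsupport hx
  have hIA : Integrable fun x => U x ^ (-(13 / 2) : ℝ) * φ x ^ 8 :=
    ((hUp _).mul (hφ.continuous.pow 8)).integrable_of_hasCompactSupport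
      (HasCompactSupport.intro hφc fun x hx => by simp [hs x hx])
  have hIE : Integrable fun x => U x ^ (-(9 / 2) : ℝ) * φ x ^ 6 * ‖gradient φ x‖ ^ 2 :=
    (((hUp _).mul (hφ.continuous.pow 6)).mul (hgc.norm.pow 2)).integrable_of_hasCompactSupport
      (HasCompactSupport.intro hφc fun x hx => by simp [hs x hx])
  have hE : ∫ x, U x ^ (-(9 / 2) : ℝ) * φ x ^ 6 * ‖gradient φ x‖ ^ 2 ≤
      δ * K ^ 2 * (∫ x, U x ^ (-(13 / 2) : ℝ) * φ x ^ 8) +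
        δ ^ (-(9 / 4) : ℝ) * ∫ x, ‖gradient φ x‖ ^ 2 := by
    rw [← integral_const_mul, ← integral_const_mul,
      ← integral_add (hIA.const_mul _) (hIg.const_mul _)]
    refine integral_mono hIE ((hIA.const_mul _).add (hIg.const_mul _)) fun x => ?_
    have h2 := mul_le_mul_of_nonneg_right (rpow_mul_pow_le (hpos x) (h0 x) (h1 x) hδ0)
      (sq_nonneg ‖gradient φ x‖)
    have h3 : ‖gradient φ x‖ ^ 2 ≤ K ^ 2 := pow_le_pow_left₀ (norm_nonneg _) (hK x) 2
    have h4 : 0 ≤ δ * (U x ^ (-(13 / 2) : ℝ) * φ x ^ 8) := by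
      have := hpos x
      have := h0 x
      positivity
    have h5 := mul_le_mul_of_nonneg_left h3 h4
    dsimp only
    linarith
  have hA0 : 0 ≤ ∫ x, U x ^ (-(13 / 2) : ℝ) * φ x ^ 8 := integral_nonneg fun x => by
    have := hpos x
    have := h0 x
    dsimp only
    positivity
  have := mul_le_mul_of_nonneg_right hδK hA0
  linarith

end Estimate

/-! ### Localization, the lower bound at the centre, and the conclusion. -/

/-- Cutting off a stable solution away from a ball gives a global positive `C²` function. -/
theorem exists_global_extension {n : ℕ} {Ω : Set (EuclideanSpace ℝ (Fin n))} (hΩ : IsOpen Ω)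
    {u : EuclideanSpace ℝ (Fin n) → ℝ} (hu : IsPositiveStableSolution Ω u)
    {x₀ : EuclideanSpace ℝ (Fin n)} {R : ℝ} (hR : 0 < R) (hRΩ : Metric.closedBall x₀ (2 * R) ⊆ Ω) :
    ∃ U : EuclideanSpace ℝ (Fin n) → ℝ, ContDiff ℝ 2 U ∧ (∀ x, 0 < U x) ∧
      (HasCompactSupport fun x => U x - 1) ∧ U x₀ = u x₀ ∧
      (∀ x ∈ Metric.ball x₀ R, Laplacian.laplacian U x = 1 / U x) ∧
      (∀ ζ : EuclideanSpace ℝ (Fin n) → ℝ, ContDiff ℝ 1 ζ → HasCompactSupport ζ →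
        tsupport ζ ⊆ Metric.ball x₀ R →
        ∫ x, ζ x ^ 2 / U x ^ 2 ≤ ∫ x, ‖gradient ζ x‖ ^ 2) := by
  let χ : ContDiffBump x₀ := ⟨R, 2 * R, hR, by linarith⟩
  have hχΩ : tsupport χ ⊆ Ω := by rw [χ.tsupport_eq]; exact hRΩ
  have hχ0 : ∀ x ∉ tsupport χ, χ x = 0 := fun x hx => image_eq_zero_of_notMem_tsupport hx
  have hball : Metric.ball x₀ R ⊆ Ω :=
    (Metric.ball_subset_closedBall.trans (Metric.closedBall_subset_closedBall (by linarith))).trans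
      hRΩ
  -- A convex combination of `u` and `1`, hence positive.
  let U : EuclideanSpace ℝ (Fin n) → ℝ := fun x => 1 + χ x * (u x - 1)
  have hUu : ∀ x ∈ Metric.closedBall x₀ R, U x = u x := by
    intro x hx
    have : χ x = 1 := χ.one_of_mem_closedBall hx
    simp only [U, this]
    ring
  refine ⟨U, ?_, ?_, ?_, hUu _ (Metric.mem_closedBall_self hR.le), ?_, ?_⟩
  · rw [contDiff_iff_contDiffAt]
    intro x
    by_cases hx : x ∈ tsupport χ
    · have hux : ContDiffAt ℝ 2 u x :=
        hu.isPositiveSolution.contDiffOn.contDiffAt (hΩ.mem_nhds (hχΩ hx))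
      exact contDiffAt_const.add (χ.contDiffAt.mul (hux.sub contDiffAt_const))
    · have : U =ᶠ[nhds x] fun _ => 1 := by
        filter_upwards [(isClosed_tsupport χ).isOpen_compl.mem_nhds hx] with z hz
        simp [U, hχ0 z hz]
      exact contDiffAt_const.congr_of_eventuallyEq this
  · intro x
    by_cases hx : x ∈ tsupport χ
    · have h1 := hu.isPositiveSolution.pos x (hχΩ hx)
      have h2 : 0 ≤ χ x := χ.nonneg
      have h3 : χ x ≤ 1 := χ.le_one
      change 0 < 1 + χ x * (u x - 1)
      rcases h2.eq_or_lt with h | h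
      · rw [← h]; norm_num
      · nlinarith [mul_pos h h1]
    · simp [U, hχ0 x hx]
  · exact HasCompactSupport.intro χ.hasCompactSupport fun x hx => by simp [U, hχ0 x hx]
  · intro x hx
    have h : U =ᶠ[nhds x] u := by
      filter_upwards [Metric.isOpen_ball.mem_nhds hx] with z hz
      exact hUu z (Metric.ball_subset_closedBall hz)
    rw [(laplacian_congr_nhds h).eq_of_nhds, hUu x (Metric.ball_subset_closedBall hx)]
    exact hu.isPositiveSolution.laplacian_eq x (hball hx)
  · intro ζ hζ hζc hζs
    have h1 := hu.stable ζ hζ hζc (hζs.trans hball)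
    have hz : ∀ x, x ∉ Ω → x ∉ tsupport ζ := fun x hx hx' => hx (hball (hζs hx'))
    rw [setIntegral_eq_integral_of_forall_compl_eq_zero (fun x hx => by
        simp [image_eq_zero_of_notMem_tsupport (hz x hx)]),
      setIntegral_eq_integral_of_forall_compl_eq_zero (fun x hx => by
        simp [gradient_eq_zero_of_notMem_tsupport (hz x hx)])] at h1
    refine le_of_eq_of_le (integral_congr_ae (Filter.Eventually.of_forall fun x => ?_)) h1
    by_cases hx : x ∈ tsupport ζ
    · simp only [hUu x (Metric.ball_subset_closedBall (hζs hx))]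
    · simp [image_eq_zero_of_notMem_tsupport hx]

/-- Change of variables, with `h` a compactly supported majorant agreeing with `g` where the
rescaled weight lives; it transfers the integral bound to all small balls. -/
theorem integral_weight_mul_comp_affine_le {n : ℕ} {w g h : EuclideanSpace ℝ (Fin n) → ℝ}
    {x₀ : EuclideanSpace ℝ (Fin n)} {s c : ℝ} (hs : 0 < s) (hw : Continuous w)
    (hw0 : ∀ y, 0 ≤ w y) (hwc : ∀ y, w y ≤ c) (hw1 : ∀ y, 1 ≤ ‖y‖ → w y = 0)
    (hg : Continuous g) (hh : Continuous h) (hhc : HasCompactSupport h) (hh0 : ∀ x, 0 ≤ h x)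
    (hgh : ∀ x ∈ Metric.ball x₀ s, g x = h x) :
    ∫ y, w y * g (x₀ + s • y) ≤ c * (∫ x, h x) * (s ^ n)⁻¹ := by
  have hwcs : HasCompactSupport w :=
    HasCompactSupport.intro (isCompact_closedBall 0 1) fun x hx => hw1 x (by
      simp only [Metric.mem_closedBall, dist_zero_right, not_le] at hx; exact hx.le)
  have hI : Integrable fun y => h (x₀ + s • y) :=
    ((hh.integrable_of_hasCompactSupport hhc).comp_add_left x₀).comp_smul hs.ne'
  have e : ∫ y, h (x₀ + s • y) = (s ^ n)⁻¹ * ∫ x, h x := by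
    rw [Measure.integral_comp_smul_of_nonneg volume (fun z => h (x₀ + z)) s (hR := hs.le),
      integral_add_left_eq_self h x₀]
    simp
  calc ∫ y, w y * g (x₀ + s • y) ≤ ∫ y, c * h (x₀ + s • y) := by
        refine integral_mono ((hw.mul (hg.comp (by fun_prop))).integrable_of_hasCompactSupport
          hwcs.mul_right) (hI.const_mul c) fun y => ?_
        dsimp only
        have hc : 0 ≤ c := (hw0 y).trans (hwc y)
        rcases le_or_gt 1 ‖y‖ with hy | hy
        · rw [hw1 y hy, zero_mul]
          exact mul_nonneg hc (hh0 _)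
        · have hm : x₀ + s • y ∈ Metric.ball x₀ s := by
            rw [Metric.mem_ball, dist_eq_norm, add_sub_cancel_left, norm_smul,
              Real.norm_of_nonneg hs.le]
            nlinarith
          rw [hgh _ hm]
          exact mul_le_mul_of_nonneg_right (hwc y) (hh0 _)
    _ = _ := by rw [integral_const_mul, e]; ring

/-- A Markov-type bound: with `k = (2t)^(-13/2)`, the affine function `k (1 - v/(2t))` lies below
`v^(-13/2)` for `v > 0`, and integrating it against the weight uses only the mean of `V`. -/
theorem le_integral_ballWeight_mul_rpow {n : ℕ} {V : EuclideanSpace ℝ (Fin n) → ℝ}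
    (hV : Continuous V) (hpos : ∀ y, 0 < V y) {t : ℝ} (ht : 0 < t)
    (hM : ∫ y, ballWeight y * V y ≤ (∫ y : EuclideanSpace ℝ (Fin n), ballWeight y) * t) :
    (2 * t) ^ (-(13 / 2) : ℝ) * ((∫ y : EuclideanSpace ℝ (Fin n), ballWeight y) / 2) ≤
      ∫ y, ballWeight y * V y ^ (-(13 / 2) : ℝ) := by
  have hw := continuous_ballWeight (E := EuclideanSpace ℝ (Fin n))
  have hwc := hasCompactSupport_ballWeight (E := EuclideanSpace ℝ (Fin n))
  set k := (2 * t) ^ (-(13 / 2) : ℝ) with hk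
  have hk0 : 0 < k := by positivity
  have hI0 := hw.integrable_of_hasCompactSupport hwc (μ := volume)
  have hI1 : Integrable fun y => ballWeight y * V y :=
    (hw.mul hV).integrable_of_hasCompactSupport hwc.mul_right
  have hI2 : Integrable fun y => ballWeight y * V y ^ (-(13 / 2) : ℝ) :=
    (hw.mul (hV.rpow_const fun y => Or.inl (hpos y).ne')).integrable_of_hasCompactSupport
      hwc.mul_right
  have h1 : ∫ y, (k * ballWeight y - k / (2 * t) * (ballWeight y * V y)) ≤
      ∫ y, ballWeight y * V y ^ (-(13 / 2) : ℝ) := by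
    refine integral_mono ((hI0.const_mul _).sub (hI1.const_mul _)) hI2 fun y => ?_
    have h2 : k * (1 - V y / (2 * t)) ≤ V y ^ (-(13 / 2) : ℝ) := by
      have hv := hpos y
      rcases le_total (2 * t) (V y) with h | h
      · have h3 : 1 ≤ V y / (2 * t) := by rwa [one_le_div (by positivity)]
        have h4 : 0 < V y ^ (-(13 / 2) : ℝ) := by positivity
        nlinarith
      · have h3 : k ≤ V y ^ (-(13 / 2) : ℝ) := Real.rpow_le_rpow_of_nonpos hv h (by norm_num)
        have h4 : 0 < V y / (2 * t) := by positivity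
        nlinarith
    have h5 := mul_le_mul_of_nonneg_left h2 (ballWeight_nonneg y)
    calc _ = ballWeight y * (k * (1 - V y / (2 * t))) := by ring
      _ ≤ _ := h5
  rw [integral_sub (hI0.const_mul _) (hI1.const_mul _), integral_const_mul,
    integral_const_mul] at h1
  have h6 := mul_le_mul_of_nonneg_left hM (show 0 ≤ k / (2 * t) by positivity)
  have h7 : k / (2 * t) * ((∫ y : EuclideanSpace ℝ (Fin n), ballWeight y) * t) =
      k * ((∫ y : EuclideanSpace ℝ (Fin n), ballWeight y) / 2) := by
    field_simp
  linarith

theorem integral_ballWeight_pos (n : ℕ) :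
    0 < ∫ y : EuclideanSpace ℝ (Fin n), ballWeight y :=
  continuous_ballWeight.integral_pos_of_hasCompactSupport_nonneg_nonzero
    hasCompactSupport_ballWeight ballWeight_nonneg (x := 0) (by simp [ballWeight])

/-- The value of a stable solution at the centre of a ball cannot be small. -/
theorem exists_pos_le_mul_sqrt {n : ℕ} (hn : n < 7) {Ω : Set (EuclideanSpace ℝ (Fin n))}
    (hΩ : IsOpen Ω) {x₀ : EuclideanSpace ℝ (Fin n)} (hx₀ : x₀ ∈ Ω) :
    ∃ ρ c C : ℝ, 0 < ρ ∧ 0 < c ∧ ∀ u : EuclideanSpace ℝ (Fin n) → ℝ,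
      IsPositiveStableSolution Ω u → ∀ r, 0 < r → r < ρ → u x₀ ≤ r → c ≤ C * √r := by
  obtain ⟨ε, hε, hεΩ⟩ := Metric.isOpen_iff.1 hΩ x₀ hx₀
  -- `ε / 3` keeps the closed ball of radius `2R` inside `Ω`; the cap `1` lets powers of radii be
  -- compared by exponent.
  set R := min 1 (ε / 3) with hRdef
  have hR : 0 < R := by positivity
  have hR1 : R ≤ 1 := min_le_left _ _
  have hRΩ : Metric.closedBall x₀ (2 * R) ⊆ Ω := by
    refine (Metric.closedBall_subset_ball ?_).trans hεΩ
    have : R ≤ ε / 3 := min_le_right _ _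
    linarith
  let φ : ContDiffBump x₀ := ⟨R / 2, 3 * R / 4, by linarith, by linarith⟩
  have hφS : tsupport φ ⊆ Metric.ball x₀ R := by
    rw [φ.tsupport_eq]
    exact Metric.closedBall_subset_ball (by change 3 * R / 4 < R; linarith)
  obtain ⟨C, hC0, hC⟩ := exists_integral_rpow_mul_pow_le φ.contDiff φ.hasCompactSupport hφS
    (fun _ => φ.nonneg) (fun _ => φ.le_one)
  set S := ∫ y : EuclideanSpace ℝ (Fin n), ballWeight y with hS
  set P := ∫ y : EuclideanSpace ℝ (Fin n), ballPotential y with hP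
  have hS0 : 0 < S := integral_ballWeight_pos n
  have hP0 : 0 ≤ P := integral_nonneg ballPotential_nonneg
  -- Chosen so that `S r + (P + C) r = S κ r`, the bound on the mean once `u x₀ ≤ r`.
  set κ := 1 + (P + C) / S with hκ
  have hκ0 : 0 < κ := by positivity
  refine ⟨R / 2, (2 * κ) ^ (-(13 / 2) : ℝ) * (S / 2), 4 * C, by positivity, by positivity, ?_⟩
  intro u hu r hr hrR hur
  obtain ⟨U, hU, hpos, hUc, hUx, hL, hst⟩ := exists_global_extension hΩ hu hR hRΩ
  have hA := hC U hU hpos hL hst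
  have hUp : Continuous fun x => U x ^ (-(13 / 2) : ℝ) :=
    hU.continuous.rpow_const fun x => Or.inl (hpos x).ne'
  -- Used twice: with `ballPotential` for the growth of the mean, and with `ballWeight` for the
  -- final comparison.
  have hbound : ∀ (w : EuclideanSpace ℝ (Fin n) → ℝ) (c : ℝ), 0 ≤ c → Continuous w →
      (∀ y, 0 ≤ w y) → (∀ y, w y ≤ c) → (∀ y, 1 ≤ ‖y‖ → w y = 0) → ∀ s, 0 < s → s ≤ r →
      ∫ y, w y * U (x₀ + s • y) ^ (-(13 / 2) : ℝ) ≤ c * C * (s ^ n)⁻¹ := by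
    intro w c hc hw hw0 hwc hw1 s hs hsr
    refine (integral_weight_mul_comp_affine_le (g := fun x => U x ^ (-(13 / 2) : ℝ))
      (h := fun x => U x ^ (-(13 / 2) : ℝ) * φ x ^ 8) hs hw hw0 hwc hw1 hUp
      (hUp.mul (φ.continuous.pow 8)) ?_ ?_ ?_).trans ?_
    · exact HasCompactSupport.intro φ.hasCompactSupport fun x hx => by
        simp [image_eq_zero_of_notMem_tsupport hx]
    · intro x
      have := hpos x
      have := φ.nonneg (x := x)
      positivity
    · intro x hx
      have : φ x = 1 := φ.one_of_mem_closedBall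
        (Metric.ball_subset_closedBall (Metric.ball_subset_ball (by
          change s ≤ R / 2; linarith) hx))
      simp [this]
    · gcongr
  have hM := integral_ballWeight_le hn hU hUc hpos hr (by linarith : r ≤ 1) (x₀ := x₀) (C := C)
    (fun x hx => hL x (Metric.ball_subset_ball (by linarith) hx))
    (fun s hs hsr => by
      simpa using hbound ballPotential 1 zero_le_one contDiff_ballPotential.continuous
        ballPotential_nonneg ballPotential_le (fun y => ballPotential_eq_zero) s hs hsr.le) hC0
  have hM2 : ∫ y, ballWeight y * U (x₀ + r • y) ≤ S * (κ * r) := by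
    refine hM.trans ?_
    rw [hUx]
    have h1 : S * (κ * r) = S * r + (P + C) * r := by
      rw [hκ]
      field_simp
    rw [h1]
    gcongr
  have hlow := le_integral_ballWeight_mul_rpow (V := fun y => U (x₀ + r • y))
    (hU.continuous.comp (by fun_prop)) (fun y => hpos _) (by positivity : 0 < κ * r) hM2
  have hup := hbound ballWeight 4 (by norm_num) continuous_ballWeight ballWeight_nonneg
    ballWeight_le (fun y => ballWeight_eq_zero) r hr le_rfl
  have h1 := hlow.trans hup
  rw [← mul_assoc, Real.mul_rpow (by positivity) hr.le] at h1
  have h2 := mul_le_mul_of_nonneg_right h1 (show 0 ≤ r ^ (13 / 2 : ℝ) by positivity)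
  have h3 : r ^ (-(13 / 2) : ℝ) * r ^ (13 / 2 : ℝ) = 1 := by
    rw [← Real.rpow_add hr]; norm_num
  -- `13/2 - n ≥ 1/2` and `r < 1`.
  have h4 : (r ^ n)⁻¹ * r ^ (13 / 2 : ℝ) ≤ √r := by
    rw [← Real.rpow_natCast, ← Real.rpow_neg hr.le, ← Real.rpow_add hr, Real.sqrt_eq_rpow]
    refine Real.rpow_le_rpow_of_exponent_ge hr (by linarith) ?_
    have : (n : ℝ) ≤ 6 := by exact_mod_cast Nat.lt_succ_iff.mp hn
    linarith
  calc (2 * κ) ^ (-(13 / 2) : ℝ) * (S / 2)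
      = (2 * κ) ^ (-(13 / 2) : ℝ) * (S / 2) * (r ^ (-(13 / 2) : ℝ) * r ^ (13 / 2 : ℝ)) := by
        rw [h3, mul_one]
    _ = (2 * κ) ^ (-(13 / 2) : ℝ) * r ^ (-(13 / 2) : ℝ) * (S / 2) * r ^ (13 / 2 : ℝ) := by ring
    _ ≤ 4 * C * (r ^ n)⁻¹ * r ^ (13 / 2 : ℝ) := h2
    _ = 4 * C * ((r ^ n)⁻¹ * r ^ (13 / 2 : ℝ)) := by ring
    _ ≤ 4 * C * √r := by gcongr

theorem mainTheorem5 {n : ℕ} (hn : n < 7) (Ω : Set (EuclideanSpace ℝ (Fin n))) (hΩ : IsOpen Ω)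
    (u : ℕ → EuclideanSpace ℝ (Fin n) → ℝ) (hu : ∀ j, IsPositiveStableSolution Ω (u j))
    (v : EuclideanSpace ℝ (Fin n) → ℝ)
    (hv : ∀ x ∈ Ω, Filter.Tendsto (fun j => u j x) Filter.atTop (nhds (v x))) :
    ∀ x ∈ Ω, v x ≠ 0 := by
  intro x hx hvx
  obtain ⟨ρ, c, C, hρ, hc, h⟩ := exists_pos_le_mul_sqrt hn hΩ hx
  have hlim := hv x hx
  rw [hvx] at hlim
  -- For each small `r` some `u j x` is below `r`; `c` and `C` do not depend on `j`, so `r` may then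
  -- tend to `0`.
  have hr : ∀ᶠ r in nhdsWithin (0 : ℝ) (Set.Ioi 0), c ≤ C * √r := by
    filter_upwards [Ioo_mem_nhdsGT hρ] with r hr
    obtain ⟨j, hj⟩ := (hlim.eventually_lt_const hr.1).exists
    exact h (u j) (hu j) r hr.1 hr.2 hj.le
  have ht : Filter.Tendsto (fun r => C * √r) (nhdsWithin (0 : ℝ) (Set.Ioi 0)) (nhds 0) := by
    have : Continuous fun r => C * √r := by fun_prop
    simpa using (this.tendsto 0).mono_left nhdsWithin_le_nhds
  exact hc.not_ge (ge_of_tendsto ht hr)
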